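/- Let $k,n\ge 1$ be integers with $nk>1$. Let $$V(k,n)=\mathbb Z^n\setminus\bigcup_p p^k\mathbb Z^n$$ be the set of $k$-free lattice points ($p$ runs through all primes; for $k=1$ these are the visible lattice points). Let $H=\prod_p(\mathbb Z^n/p^k\mathbb Z^n)$ with the product of the discrete topologies, let $\theta_H$ be the product of the uniform probability measures on the factors, let $x^\star=(x \bmod p^k\mathbb Z^n)_p\in H$ for $x\in\mathbb Z^n$, and let $\mathcal L=\{(x,x^\star):x\in\mathbb Z^n\}\subset\mathbb Z^n\times H$. For $W\subset H$ put $\Lambda(W)=\{x\in\mathbb Z^n: x^\star\in W\}$. Equip $\mathbb Z^n$ with counting measure, and let $1/\mathrm{dens}(\mathcal L)$ be the measure of a fundamental domain of $\mathcal L$ in $\mathbb Z^n\times H$. For $D\subset\mathbb Z^n$ and finite $A\subset\mathbb Z^n$ let $$N^*_A(D,\mathbb Z^n)=\bigl|\{1_{(D-x)\cap A}: x\in\mathbb Z^n\}\bigr|$$ be the number of $01$-coloured $A$-patterns $1_{(D-x)\cap A}\colon A\to\{0,1\}$, and for a sequence $\mathcal A=(A_m)_{m\in\mathbb N}$ of non-empty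 finite sets let $$h^*_{\mathcal A}(D,\mathbb Z^n)=\limsup_{m\to\infty}\frac{1}{|A_m|}\log N^*_{A_m}(D,\mathbb Z^n).$$ The sequence $\mathcal A$ is a van Hove sequence if $|\partial^K A_m|/|A_m|\to0$ for every finite $K\subset\mathbb Z^n$, where $\partial^KA=((K+A)\setminus A)\cup((K+A^c)\cap A)$. A centred van Hove sequence of cubes is a van Hove sequence for which every $A_m$ contains $0$ and is the set of lattice points of a closed axis-parallel cube of $\mathbb R^n$. Then the following hold. 1. $(\mathbb Z^n,H,\mathcal L)$ is a cut-and-project scheme, that is, $\mathbb Z^n$ and $H$ are $\sigma$-compact locally compact Hausdorff abelian groups, $\mathcal L$ is a discrete subgroup of $\mathbb Z^n\times H$ with compact quotient, the projection $\mathcal L\to\mathbb Z^n$ is one-to-one, and the projection of $\mathcal L$ to $H$ is dense. Moreover $\theta_H$ is a Haar measure on $H$, $\mathrm{dens}(\mathcal L)=1$, and $\mathbb Z^n=\Lambda(H)$ is a regular model set (its window $H$ is relatively compact with non-empty interior, and $\theta_H(\partial H)=0$). 2. For $W=\prod_p\bigl((\mathbb Z^n/p^k\mathbb Z^n)\setminus\{0\}\bigr)$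 we have $V(k,n)=\Lambda(W)$, $W$ is relatively compact, $W=\partial W$, and $\theta_H(W)=1/\zeta(nk)>0$. 3. The complement satisfies $\mathbb Z^n\setminus V(k,n)=\Lambda(H\setminus W)$, where $H\setminus W$ is relatively compact with non-empty interior. 4. For every centred van Hove sequence $\mathcal A$ of cubes, $$h^*_{\mathcal A}(V(k,n),\mathbb Z^n)=\theta_H(W)\log2=\mathrm{dens}(\mathcal L)\,\theta_H(\partial W)\log 2$$ and $$h^*_{\mathcal A}(\mathbb Z^n\setminus V(k,n),\mathbb Z^n)=h^*_{\mathcal A}(V(k,n),\mathbb Z^n)=\mathrm{dens}(\mathcal L)\,\theta_H(\partial(H\setminus W))\log 2 .$$ That is, the general upper bound $\mathrm{dens}(\mathcal L)\,\theta_H(\partial W)\log2$ for the coloured pattern entropy of a weak model set $\Lambda(W)$ relative to a regular model set containing it is attained by the $k$-free lattice points and by their complement; in particular it is attained by the visible ($k=1$, $n\ge2$) and by the invisible lattice points. -/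

import Mathlib

open MeasureTheory Filter Topology
open scoped Pointwise

noncomputable section

namespace WeakModelSet

/-! ### Cut-and-project schemes, projection sets, van Hove sequences (abelian groups, written
additively) -/

/-- `(G, H, L)` is a cut-and-project scheme: `G` and `H` are σ-compact locally compact Hausdorff
abelian groups, `L` is a discrete cocompact subgroup of `G × H`, the projection to `G` is injective
on `L`, and the projection of `L` to `H` is dense. -/
structure IsCutAndProjectScheme (G H : Type*) [AddCommGroup G] [TopologicalSpace G]
    [AddCommGroup H] [TopologicalSpace H] (L : AddSubgroup (G × H)) : Prop where
  isTopologicalAddGroup_direct : IsTopologicalAddGroup G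
  t2Space_direct : T2Space G
  locallyCompactSpace_direct : LocallyCompactSpace G
  sigmaCompactSpace_direct : SigmaCompactSpace G
  isTopologicalAddGroup_internal : IsTopologicalAddGroup H
  t2Space_internal : T2Space H
  locallyCompactSpace_internal : LocallyCompactSpace H
  sigmaCompactSpace_internal : SigmaCompactSpace H
  discrete : DiscreteTopology L
  cocompact : CompactSpace ((G × H) ⧸ L)
  injOn_fst : Set.InjOn Prod.fst (L : Set (G × H))
  dense_snd : Dense (Prod.snd '' (L : Set (G × H)))

/-- The projection set `Λ(W)`: the points `ℓ` of the projection of `L` to `G` with `ℓ⋆ ∈ W`. -/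
def projectionSet {G H : Type*} [AddCommGroup G] [AddCommGroup H] (L : AddSubgroup (G × H))
    (W : Set H) : Set G :=
  {x | ∃ h ∈ W, (x, h) ∈ L}

/-- The density `dens(L)` of the lattice `L` in `G × H`: the reciprocal of the measure of a
fundamental domain, for the product of the given measures on `G` and `H`. -/
def latticeDensity {G H : Type*} [AddCommGroup G] [AddCommGroup H] [MeasurableSpace G]
    [MeasurableSpace H] (L : AddSubgroup (G × H)) (θG : Measure G) (θH : Measure H) : ℝ :=
  1 / (addCovolume L (G × H) (θG.prod θH)).toReal

/-- `W` is the window of a regular model set: it is relatively compact, has non-empty interior, and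
its boundary has measure zero. -/
def IsRegularWindow {H : Type*} [TopologicalSpace H] [MeasurableSpace H] (θH : Measure H)
    (W : Set H) : Prop :=
  IsCompact (closure W) ∧ (interior W).Nonempty ∧ θH (frontier W) = 0

/-- The (generalised) van Hove boundary `∂^U W`. -/
def vanHoveBoundary {G : Type*} [AddCommGroup G] [TopologicalSpace G] (U W : Set G) : Set G :=
  ((U + closure W) ∩ closure Wᶜ) ∪ ((U + closure Wᶜ) ∩ closure W)

/-- `A` is a (generalised) van Hove sequence in `G` with respect to the Haar measure `θ`. -/
def IsVanHove {G : Type*} [AddCommGroup G] [TopologicalSpace G] [MeasurableSpace G]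
    (θ : Measure G) (A : ℕ → Set G) : Prop :=
  (∀ m, IsCompact (A m) ∧ 0 < θ (A m)) ∧
    ∀ K : Set G, IsCompact K →
      Tendsto (fun m => θ (vanHoveBoundary K (A m)) / θ (A m)) atTop (𝓝 0)

/-! ### Coloured pattern entropy -/

/-- The centred coloured `A`-patterns of `D ⊆ D₀`. The pattern centred in `x ∈ D₀` is the
`01`-colouring `1_{(D - x) ∩ A} : (D₀ - x) ∩ A → {0,1}`; it is recorded as the pair consisting of
the domain of this function and the set where it takes the value `1`. -/
def colouredPatterns {G : Type*} [AddCommGroup G] (A D D₀ : Set G) : Set (Set G × Set G) :=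
  (fun x => ({a | x + a ∈ D₀} ∩ A, {a | x + a ∈ D} ∩ A)) '' D₀

/-- The complexity `N*_A(D, D₀)` (finite whenever `D₀` has finite local complexity and `A` is
compact). -/
def colouredComplexity {G : Type*} [AddCommGroup G] (A D D₀ : Set G) : ℕ :=
  (colouredPatterns A D D₀).ncard

/-- The coloured pattern entropy `h*_𝒜(D, D₀)`, as an extended real number. -/
def colouredPatternEntropy {G : Type*} [AddCommGroup G] [MeasurableSpace G] (θ : Measure G)
    (A : ℕ → Set G) (D D₀ : Set G) : EReal :=
  limsup (fun m =>
    ((Real.log (colouredComplexity (A m) D D₀) / θ.real (A m) : ℝ) : EReal)) atTop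

/-- The upper bound `dens(L) θ_H(∂W) log 2` for the pattern entropy of the weak model set
`Λ(W)`. -/
def entropyBound {G H : Type*} [AddCommGroup G] [AddCommGroup H] [MeasurableSpace G]
    [MeasurableSpace H] [TopologicalSpace H] (L : AddSubgroup (G × H)) (θG : Measure G)
    (θH : Measure H) (W : Set H) : ℝ :=
  latticeDensity L θG θH * θH.real (frontier W) * Real.log 2

/-! ### The scheme for subsets of `ℤⁿ` and the `k`-free lattice points -/

/-- The subgroup `p^k ℤⁿ` of `ℤⁿ`. -/
def powSublattice (k n : ℕ) (p : Nat.Primes) : AddSubgroup (Fin n → ℤ) :=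
  (nsmulAddMonoidHom (α := Fin n → ℤ) ((p : ℕ) ^ k)).range

/-- The finite group `ℤⁿ / p^k ℤⁿ`, with the discrete topology and σ-algebra (both arise as
quotient structures of those of `ℤⁿ`). -/
abbrev Residue (k n : ℕ) (p : Nat.Primes) : Type := (Fin n → ℤ) ⧸ powSublattice k n p

/-- The compact group `H = ∏_p ℤⁿ / p^k ℤⁿ`, with the product topology. -/
abbrev Internal (k n : ℕ) : Type := (p : Nat.Primes) → Residue k n p

lemma mem_powSublattice {k n : ℕ} {p : Nat.Primes} {x : Fin n → ℤ} :
    x ∈ powSublattice k n p ↔ ∀ i, ((p : ℕ) ^ k : ℤ) ∣ x i := by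
  constructor
  · rintro ⟨y, rfl⟩ i
    exact ⟨y i, by simp⟩
  · intro h
    choose y hy using h
    exact ⟨y, by ext i; simp [hy i]⟩

instance (k n : ℕ) (p : Nat.Primes) : DiscreteTopology (Residue k n p) :=
  QuotientAddGroup.discreteTopology (isOpen_discrete _)

instance (k n : ℕ) (p : Nat.Primes) : Finite (Residue k n p) := by
  have : NeZero ((p : ℕ) ^ k) := ⟨pow_ne_zero _ p.2.ne_zero⟩
  let f : (Fin n → ℤ) →+ (Fin n → ZMod ((p : ℕ) ^ k)) :=
    (Int.castAddHom (ZMod ((p : ℕ) ^ k))).compLeft (Fin n)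
  have hf : f.ker = powSublattice k n p := by
    ext x
    rw [mem_powSublattice, AddMonoidHom.mem_ker, funext_iff]
    refine forall_congr' fun i => ?_
    have := ZMod.intCast_zmod_eq_zero_iff_dvd (x i) ((p : ℕ) ^ k)
    simpa [f] using this
  have hfin : Finite ((Fin n → ℤ) ⧸ f.ker) :=
    Finite.of_injective _ (QuotientAddGroup.kerLift_injective f)
  rw [hf] at hfin
  exact hfin

instance (k n : ℕ) (p : Nat.Primes) : MeasurableSingletonClass (Residue k n p) :=
  ⟨fun _ => MeasurableSpace.map_def.2 (MeasurableSet.of_discrete)⟩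

instance (k n : ℕ) (p : Nat.Primes) :
    IsProbabilityMeasure (ProbabilityTheory.uniformOn (Set.univ : Set (Residue k n p))) :=
  ProbabilityTheory.isProbabilityMeasure_uniformOn Set.finite_univ Set.univ_nonempty

/-- The measure `θ_H` on `H`: the product of the uniform probability measures on the factors. -/
def internalHaar (k n : ℕ) : Measure (Internal k n) :=
  Measure.infinitePi fun p => ProbabilityTheory.uniformOn (Set.univ : Set (Residue k n p))

/-- The star map `x ↦ x⋆ = (x mod p^k ℤⁿ)_p`. -/
def starMap (k n : ℕ) : (Fin n → ℤ) →+ Internal k n :=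
  AddMonoidHom.pi fun p => QuotientAddGroup.mk' (powSublattice k n p)

/-- The lattice `{(x, x⋆) : x ∈ ℤⁿ}` in `ℤⁿ × H`. -/
def diagonalLattice (k n : ℕ) : AddSubgroup ((Fin n → ℤ) × Internal k n) :=
  ((AddMonoidHom.id (Fin n → ℤ)).prod (starMap k n)).range

/-- The `k`-free lattice points `V(k, n) = ℤⁿ \ ⋃_p p^k ℤⁿ`. -/
def kFree (k n : ℕ) : Set (Fin n → ℤ) :=
  Set.univ \ ⋃ p : Nat.Primes, (powSublattice k n p : Set (Fin n → ℤ))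

/-- The window `W = ∏_p (ℤⁿ / p^k ℤⁿ) \ {0}`. -/
def kFreeWindow (k n : ℕ) : Set (Internal k n) :=
  Set.pi Set.univ fun _ => {0}ᶜ

/-- `A ⊆ ℤⁿ` consists of the lattice points of a closed axis-parallel cube in `ℝⁿ`. -/
def IsCube {n : ℕ} (A : Set (Fin n → ℤ)) : Prop :=
  ∃ (c : Fin n → ℝ) (r : ℝ), A = {x | ∀ i, |(x i : ℝ) - c i| ≤ r}

end WeakModelSet

end

namespace WeakModelSet

/-! ### Chinese remainders and sieving -/

/-! The entropy comes from bounding, above and below, the number of patterns of the `k`-free points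
`V` in a finite set `A`.

Lower bound: for `h` in `H` let `S` be the set of `a ∈ A` with `h + a⋆ ∈ W`. By translation
invariance its mean size over `H` is `|A| θ_H(W)`, so some `S` is at least that large. Every `T ⊆ S`
is then exactly a pattern of `V` in `A` (`exists_forall_add_mem_kFree_iff`): by Chinese remainders
each `a ∈ A \ T` gets its own prime `p` with `x + a ∈ p^k ℤⁿ`, while at the other prescribed primes
`x` takes the residues of `h`, which are harmless for `T`. Keeping `x + T` out of `p^k ℤⁿ` for all
remaining primes is a sieve problem (`exists_translate_kFree`). For `n ≥ 2` two coordinates give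
enough freedom; for `n = 1` one has `k ≥ 2`, and convergence of `∑ 1/q²` suffices. Hence there are
at least `2^|S|` patterns, for every `A`.

Upper bound: for a finite set `F` of primes, `V` avoids the zero class modulo `p^k` for each `p ∈
F`. Once the class of `x` in the finite quotient is fixed, a pattern is a subset of the points of
`A` that survive these conditions, and these number at most `|A| ∏_{p ∈ F} (1 - p^(-nk))` plus a
boundary term (`log_colouredComplexity_le`). Along a van Hove sequence the number of classes and the
boundary are negligible, and the products tend to `θ_H(W) = 1/ζ(nk)`.

Finally `W` is closed with empty interior, so `W = ∂W`; complementation preserves both the boundary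
and the number of patterns. -/

lemma exists_forall_pow_dvd_sub (k : ℕ) (F : Finset Nat.Primes) (c : Nat.Primes → ℤ) :
    ∃ x : ℤ, ∀ p ∈ F, ((p : ℕ) ^ k : ℤ) ∣ x - c p := by
  obtain ⟨x, hx⟩ := Ideal.exists_forall_sub_mem_ideal
    (I := fun p : F => Ideal.span {(((p : Nat.Primes) : ℕ) ^ k : ℤ)}) (by
      intro p q hpq
      rw [Function.onFun, Ideal.isCoprime_span_singleton_iff]
      refine IsCoprime.pow ?_
      rw [Nat.isCoprime_iff_coprime]
      exact (Nat.coprime_primes p.1.2 q.1.2).2 fun h => hpq (Subtype.ext (Subtype.ext h)))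
    fun p => c p
  exact ⟨x, fun p hp => Ideal.mem_span_singleton.1 (hx ⟨p, hp⟩)⟩

/-- Pigeonhole: the forbidden residues `-s` cannot fill `ZMod m`. -/
lemma exists_forall_not_dvd_add (S : Finset ℤ) (m : ℕ) (h : S.card < m) :
    ∃ b : ℤ, ∀ s ∈ S, ¬ (m : ℤ) ∣ b + s := by
  have : NeZero m := ⟨by omega⟩
  obtain ⟨b, hb⟩ : ∃ b : ZMod m, b ∉ S.image fun s : ℤ => (-s : ZMod m) := by
    by_contra! H
    have h1 : (S.image fun s : ℤ => (-s : ZMod m)) = Finset.univ :=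
      Finset.eq_univ_iff_forall.2 H
    have h2 := Finset.card_image_le (s := S) (f := fun s : ℤ => (-s : ZMod m))
    rw [h1, Finset.card_univ, ZMod.card] at h2
    omega
  obtain ⟨b, rfl⟩ := ZMod.intCast_surjective b
  refine ⟨b, fun s hs hd => hb (Finset.mem_image.2 ⟨s, hs, ?_⟩)⟩
  have := (ZMod.intCast_zmod_eq_zero_iff_dvd _ _).2 hd
  push_cast at this
  exact (eq_neg_of_add_eq_zero_left this).symm

/-- As `M` is invertible modulo `d`, the solutions lie in one residue class, hence at most one in
each block of length `d`; `j / d` is the index of the block. -/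
lemma card_filter_dvd_add_mul_le (J d : ℕ) (y M : ℤ) (h : IsCoprime (d : ℤ) M) :
    ((Finset.range J).filter fun j : ℕ => (d : ℤ) ∣ y + M * j).card ≤ J / d + 1 := by
  rw [← Finset.card_range (J / d + 1)]
  refine Finset.card_le_card_of_injOn (· / d) ?_ ?_
  · intro j hj
    simp only [Finset.coe_filter, Finset.mem_range, Set.mem_ofPred_eq] at hj
    simpa [Nat.lt_succ_iff] using Nat.div_le_div_right hj.1.le
  · intro i hi j hj hij
    simp only [Finset.coe_filter, Finset.mem_range, Set.mem_ofPred_eq] at hi hj hij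
    have h1 : (d : ℤ) ∣ M * ((i : ℤ) - j) := by
      have h0 := dvd_sub hi.2 hj.2
      rwa [show y + M * i - (y + M * j) = M * ((i : ℤ) - j) by ring] at h0
    have h2 : (j : ℤ) ≡ i [ZMOD d] := (Int.modEq_iff_dvd).2 (h.dvd_of_dvd_mul_left h1)
    have h3 : j % d = i % d := Int.natCast_modEq_iff.1 h2
    rw [← Nat.div_add_mod i d, ← Nat.div_add_mod j d, hij, h3]

/-- The sum of `1/q²` beyond `P` telescopes to at most `1/P`, and the rounding terms contribute at
most `N`. This bounds the number of terms sieved out for one point of the set. -/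
lemma sum_div_add_one_le {P N J : ℕ} (hP : P ≠ 0) :
    (∑ q ∈ Finset.Ioc P N, ((J / q ^ 2 : ℕ) + 1 : ℝ)) ≤ J / P + N := by
  have h1 : (∑ q ∈ Finset.Ioc P N, ((q : ℝ) ^ 2)⁻¹) ≤ (P : ℝ)⁻¹ := by
    rcases le_total P N with h | h
    · have := sum_Ioc_inv_sq_le_sub (α := ℝ) hP h
      have h0 : (0 : ℝ) ≤ (N : ℝ)⁻¹ := by positivity
      linarith
    · rw [Finset.Ioc_eq_empty (by omega)]; simp
  calc (∑ q ∈ Finset.Ioc P N, ((J / q ^ 2 : ℕ) + 1 : ℝ))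
      ≤ ∑ q ∈ Finset.Ioc P N, (J * ((q : ℝ) ^ 2)⁻¹ + 1) := by
        refine Finset.sum_le_sum fun q _ => ?_
        have := Nat.cast_div_le (α := ℝ) (m := J) (n := q ^ 2)
        push_cast at this
        rw [← div_eq_mul_inv]
        linarith
    _ = J * (∑ q ∈ Finset.Ioc P N, ((q : ℝ) ^ 2)⁻¹) + (Finset.Ioc P N).card := by
        rw [Finset.sum_add_distrib, Finset.mul_sum]; simp
    _ ≤ J * (P : ℝ)⁻¹ + N := by
        have : ((Finset.Ioc P N).card : ℝ) ≤ N := by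
          rw [Nat.card_Ioc]; exact_mod_cast Nat.sub_le _ _
        gcongr
    _ = _ := by rw [div_eq_mul_inv]

/-- In an arithmetic progression there is a term whose translates by a finite set avoid all
squares of primes coprime to the modulus and large compared with the size of the set. -/
lemma exists_forall_not_sq_dvd (S : Finset ℤ) (P : ℕ) (hP : 2 * S.card < P) (x₀ M : ℤ)
    (hM : 0 < M) (hx : ∀ s ∈ S, 0 < x₀ + s) :
    ∃ j : ℕ, ∀ s ∈ S, ∀ p : ℕ, p.Prime → P < p → IsCoprime (p : ℤ) M →
      ¬ ((p : ℤ) ^ 2 ∣ x₀ + s + M * j) := by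
  classical
  obtain ⟨C, hC⟩ : ∃ C : ℕ, ∀ s ∈ S, x₀ + s ≤ C := by
    obtain ⟨C, hC⟩ := (S.image fun s => x₀ + s).finite_toSet.bddAbove
    refine ⟨C.toNat, fun s hs => (hC (Finset.mem_coe.2 (Finset.mem_image_of_mem _ hs))).trans
      (Int.self_le_toNat C)⟩
  -- choose the length `J = K ^ 2` of the progression
  set c : ℕ := S.card
  set B : ℕ := C + M.toNat + 1
  -- The sieve removes at most `c (J/P + N) ≤ J/2 + c B K` of the `J = K²` terms; this is less than
  -- `J` because `K > 2 c B`.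
  set K : ℕ := 2 * c * B + 1 with hK
  set J : ℕ := K ^ 2 with hJ
  set N : ℕ := B * K with hN
  have hMB : M ≤ B - 1 - C := by simp [B]
  -- A prime whose square divides one of these positive numbers is at most `N`, so only primes in
  -- `(P, N]` have to be sieved.
  have hbound : ∀ s ∈ S, ∀ j < J, x₀ + s + M * j < ((N : ℤ) + 1) ^ 2 := by
    intro s hs j hj
    have h1 := hC s hs
    have hj' : (j : ℤ) ≤ (K : ℤ) ^ 2 := by exact_mod_cast hj.le
    have hK1 : (1 : ℤ) ≤ (K : ℤ) := by exact_mod_cast Nat.le_add_left 1 (2 * c * B)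
    have hB1 : (1 : ℤ) ≤ (B : ℤ) := by exact_mod_cast Nat.le_add_left 1 (C + M.toNat)
    have hC0 : (0 : ℤ) ≤ C := by positivity
    have hN' : (N : ℤ) = B * K := by simp [hN]
    rw [hN']
    calc x₀ + s + M * j ≤ C + M * (K : ℤ) ^ 2 := by gcongr
      _ ≤ C * (K : ℤ) ^ 2 + M * (K : ℤ) ^ 2 := by
          have : (1 : ℤ) ≤ (K : ℤ) ^ 2 := one_le_pow₀ hK1
          nlinarith
      _ ≤ B * (K : ℤ) ^ 2 := by nlinarith [sq_nonneg (K : ℤ)]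
      _ ≤ (B * K : ℤ) ^ 2 := by
          rw [mul_pow]
          gcongr
          exact le_self_pow₀ hB1 (by norm_num)
      _ < _ := by
          have : (0 : ℤ) ≤ B * K := by positivity
          nlinarith
  by_contra! H
  have hcover : Finset.range J ⊆ S.biUnion fun s => ((Finset.Ioc P N).filter fun p : ℕ => p.Prime ∧
      IsCoprime (p : ℤ) M).biUnion fun p : ℕ =>
        (Finset.range J).filter fun j : ℕ => ((p ^ 2 : ℕ) : ℤ) ∣ (x₀ + s) + M * j := by
    intro j hj
    obtain ⟨s, hs, p, hp, hPp, hpM, hd⟩ := H j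
    rw [Finset.mem_range] at hj
    simp only [Finset.mem_biUnion, Finset.mem_filter, Finset.mem_Ioc, Finset.mem_range]
    refine ⟨s, hs, p, ⟨⟨hPp, ?_⟩, hp, hpM⟩, hj, by exact_mod_cast hd⟩
    have hpos : 0 < x₀ + s + M * j := by
      have := hx s hs
      positivity
    have h1 := (Int.le_of_dvd hpos hd).trans_lt (hbound s hs j hj)
    have := lt_of_pow_lt_pow_left₀ 2 (by positivity) h1
    omega
  have h1 : (J : ℝ) ≤ c * (J / P + N) := by
    have h2 := Finset.card_le_card hcover
    rw [Finset.card_range] at h2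
    have h3 : J ≤ ∑ s ∈ S, ∑ q ∈ Finset.Ioc P N, (J / q ^ 2 + 1) := by
      refine h2.trans (Finset.card_biUnion_le.trans (Finset.sum_le_sum fun s _ => ?_))
      refine Finset.card_biUnion_le.trans ?_
      refine (Finset.sum_le_sum fun q hq => ?_).trans
        (Finset.sum_le_sum_of_subset (Finset.filter_subset _ _))
      rw [Finset.mem_filter] at hq
      refine card_filter_dvd_add_mul_le J (q ^ 2) _ _ ?_
      push_cast
      exact hq.2.2.pow_left
    calc (J : ℝ) ≤ ∑ s ∈ S, ∑ q ∈ Finset.Ioc P N, ((J / q ^ 2 : ℕ) + 1 : ℝ) := by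
          exact_mod_cast h3
      _ ≤ ∑ s ∈ S, ((J : ℝ) / P + N) :=
          Finset.sum_le_sum fun s _ => sum_div_add_one_le (by omega)
      _ = _ := by rw [Finset.sum_const, nsmul_eq_mul]
  have hP' : (2 * c : ℝ) ≤ P := by exact_mod_cast hP.le
  have hP0 : (0 : ℝ) < P := by exact_mod_cast (by omega : 0 < P)
  have h4 : (c : ℝ) * (J / P) ≤ J / 2 := by
    rw [mul_div_assoc', div_le_div_iff₀ hP0 two_pos]
    nlinarith [(Nat.cast_nonneg J : (0 : ℝ) ≤ J)]
  have h5 : (J : ℝ) = K ^ 2 := by simp [hJ]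
  have h6 : (N : ℝ) = B * K := by simp [hN]
  have h7 : (K : ℝ) = 2 * c * B + 1 := by simp [hK]
  have h8 : (0 : ℝ) ≤ c * B := by positivity
  have h9 : (0 : ℝ) < K := by rw [h7]; positivity
  rw [mul_add] at h1
  have h10 : (K : ℝ) ^ 2 ≤ 2 * (c * (B * K)) := by
    rw [h5] at h1 h4
    rw [h6] at h1
    linarith
  nlinarith

/-! ### Translates of finite sets consisting of `k`-free points -/

lemma mem_kFree {k n : ℕ} {x : Fin n → ℤ} :
    x ∈ kFree k n ↔ ∀ p : Nat.Primes, x ∉ powSublattice k n p := by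
  simp [kFree]

lemma finite_setOf_pow_dvd {k : ℕ} (hk : k ≠ 0) {a : ℤ} (ha : a ≠ 0) :
    {p : Nat.Primes | ((p : ℕ) ^ k : ℤ) ∣ a}.Finite := by
  have h : ((fun p : Nat.Primes => (p : ℕ)) ⁻¹' {m : ℕ | m ∣ a.natAbs}).Finite := by
    refine Set.Finite.preimage Subtype.val_injective.injOn ?_
    exact (Nat.divisors a.natAbs).finite_toSet.subset fun m hm =>
      Finset.mem_coe.2 (Nat.mem_divisors.2 ⟨hm, Int.natAbs_ne_zero.2 ha⟩)
  refine h.subset fun p hp => ?_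
  exact Int.natCast_dvd.1 ((dvd_pow_self _ hk).trans hp)

lemma finite_setOf_mem_powSublattice {k n : ℕ} (hk : k ≠ 0) {v : Fin n → ℤ} (hv : v ≠ 0) :
    {p : Nat.Primes | v ∈ powSublattice k n p}.Finite := by
  obtain ⟨i, hi⟩ := Function.ne_iff.1 hv
  exact (finite_setOf_pow_dvd hk hi).subset fun p hp => mem_powSublattice.1 hp i

lemma finite_setOf_primes_le (P : ℕ) : {p : Nat.Primes | (p : ℕ) ≤ P}.Finite :=
  (Set.finite_Iic P).preimage Subtype.val_injective.injOn

lemma exists_forall_sub_mem_powSublattice (k n : ℕ) (F : Finset Nat.Primes)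
    (c : Nat.Primes → Fin n → ℤ) :
    ∃ x : Fin n → ℤ, ∀ p ∈ F, x - c p ∈ powSublattice k n p := by
  choose x hx using fun i => exists_forall_pow_dvd_sub k F fun p => c p i
  exact ⟨x, fun p hp => mem_powSublattice.2 fun i => hx i p hp⟩

lemma add_mem_powSublattice_iff {k n : ℕ} {p : Nat.Primes} {x c s : Fin n → ℤ}
    (h : x - c ∈ powSublattice k n p) :
    x + s ∈ powSublattice k n p ↔ c + s ∈ powSublattice k n p := by
  rw [show x + s = (x - c) + (c + s) by abel, AddSubgroup.add_mem_cancel_left _ h]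

/-- An integer with prescribed residues modulo finitely many prime powers can be chosen
positive and as large as wanted. -/
lemma exists_forall_pow_dvd_sub_lt (k : ℕ) (F : Finset Nat.Primes) (c : Nat.Primes → ℤ) (B : ℤ) :
    ∃ x : ℤ, B < x ∧ ∀ p ∈ F, ((p : ℕ) ^ k : ℤ) ∣ x - c p := by
  obtain ⟨y, hy⟩ := exists_forall_pow_dvd_sub k F c
  set M : ℤ := ∏ p ∈ F, ((p : ℕ) ^ k : ℤ) with hM
  have hMpos : 0 < M := Finset.prod_pos fun p _ => pow_pos (by exact_mod_cast p.2.pos) k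
  -- Adding multiples of `M ≥ 1` keeps all residues; the factor is large enough to pass `B` even if
  -- `y` is negative.
  refine ⟨y + M * (|B| + |y| + 1), ?_, fun p hp => ?_⟩
  · nlinarith [le_abs_self B, neg_abs_le y, abs_nonneg B, abs_nonneg y]
  · have h1 : ((p : ℕ) ^ k : ℤ) ∣ M := Finset.dvd_prod_of_mem _ hp
    have h2 := dvd_add (hy p hp) (h1.mul_right (|B| + |y| + 1))
    rwa [show y - c p + M * (|B| + |y| + 1) = y + M * (|B| + |y| + 1) - c p by ring] at h2

/-- The sieve in dimension one: `S` has a `k`-free translate with prescribed residues. -/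
lemma exists_translate_kFree_one (k : ℕ) (hk : 2 ≤ k) (S : Finset (Fin 1 → ℤ)) :
    ∃ P : ℕ, ∀ (F : Finset Nat.Primes) (c : Nat.Primes → Fin 1 → ℤ),
      (∀ p : Nat.Primes, (p : ℕ) ≤ P → p ∈ F) →
      (∀ p ∈ F, ∀ s ∈ S, c p + s ∉ powSublattice k 1 p) →
      ∃ x : Fin 1 → ℤ, (∀ p ∈ F, x - c p ∈ powSublattice k 1 p) ∧ ∀ s ∈ S, x + s ∈ kFree k 1 := by
  classical
  set T : Finset ℤ := S.image fun s => s 0 with hT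
  refine ⟨2 * T.card + 1, fun F c hF hc => ?_⟩
  obtain ⟨B, hB⟩ : ∃ B : ℤ, ∀ t ∈ T, -t ≤ B := by
    obtain ⟨B, hB⟩ := (T.image fun t => -t).finite_toSet.bddAbove
    exact ⟨B, fun t ht => hB (Finset.mem_coe.2 (Finset.mem_image_of_mem _ ht))⟩
  obtain ⟨x₀, hx₀, hx₀F⟩ := exists_forall_pow_dvd_sub_lt k F (fun p => c p 0) B
  set M : ℤ := ∏ p ∈ F, ((p : ℕ) ^ k : ℤ) with hM
  have hMpos : 0 < M := Finset.prod_pos fun p _ => pow_pos (by exact_mod_cast p.2.pos) k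
  obtain ⟨j, hj⟩ := exists_forall_not_sq_dvd T (2 * T.card + 1) (by omega) x₀ M hMpos
    fun t ht => by linarith [hB t ht]
  have hres : ∀ p ∈ F, (fun _ : Fin 1 => x₀ + M * j) - c p ∈ powSublattice k 1 p := by
    intro p hp
    refine mem_powSublattice.2 fun i => ?_
    have h1 : ((p : ℕ) ^ k : ℤ) ∣ M := Finset.dvd_prod_of_mem _ hp
    have h2 := dvd_add (hx₀F p hp) (h1.mul_right (j : ℤ))
    rw [Subsingleton.elim i 0, Pi.sub_apply]
    rwa [show x₀ - c p 0 + M * j = x₀ + M * j - c p 0 by ring] at h2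
  refine ⟨fun _ => x₀ + M * j, hres, fun s hs => mem_kFree.2 fun p => ?_⟩
  by_cases hp : p ∈ F
  · rw [add_mem_powSublattice_iff (hres p hp)]
    exact hc p hp s hs
  · intro h
    have hlt : 2 * T.card + 1 < (p : ℕ) := by
      by_contra! hle
      exact hp (hF p hle)
    have hcop : IsCoprime ((p : ℕ) : ℤ) M := by
      refine IsCoprime.prod_right fun q hq => IsCoprime.pow_right ?_
      rw [Nat.isCoprime_iff_coprime, Nat.coprime_primes p.2 q.2]
      exact fun h => hp (Subtype.ext h ▸ hq)
    refine hj (s 0) (Finset.mem_image_of_mem _ hs) p p.2 hlt hcop ?_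
    -- Here `k ≥ 2` enters: divisibility by `p^k` gives divisibility by `p²`, which the sieve
    -- excluded.
    have h3 := (pow_dvd_pow _ hk).trans (mem_powSublattice.1 h 0)
    rwa [Pi.add_apply, show x₀ + M * j + s 0 = x₀ + s 0 + M * j by ring] at h3

/-- The sieve in higher dimensions: `S` has a `k`-free translate with prescribed residues. -/
lemma exists_translate_kFree_add_two (k n : ℕ) (hk : k ≠ 0) (S : Finset (Fin (n + 2) → ℤ)) :
    ∃ P : ℕ, ∀ (F : Finset Nat.Primes) (c : Nat.Primes → Fin (n + 2) → ℤ),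
      (∀ p : Nat.Primes, (p : ℕ) ≤ P → p ∈ F) →
      (∀ p ∈ F, ∀ s ∈ S, c p + s ∉ powSublattice k (n + 2) p) →
      ∃ x : Fin (n + 2) → ℤ, (∀ p ∈ F, x - c p ∈ powSublattice k (n + 2) p) ∧
        ∀ s ∈ S, x + s ∈ kFree k (n + 2) := by
  classical
  refine ⟨S.card, fun F c hF hc => ?_⟩
  obtain ⟨B, hB⟩ : ∃ B : ℤ, ∀ s ∈ S, -s 0 ≤ B := by
    obtain ⟨B, hB⟩ := (S.image fun s => -s 0).finite_toSet.bddAbove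
    exact ⟨B, fun s hs => hB (Finset.mem_coe.2 (Finset.mem_image_of_mem (fun s => -s 0) hs))⟩
  obtain ⟨x₀, hx₀, hx₀F⟩ := exists_forall_pow_dvd_sub_lt k F (fun p => c p 0) B
  -- Coordinate 0 is fixed first, with every `x₀ + s 0` positive. Only finitely many primes are then
  -- left dangerous, and coordinate 1 is chosen to deal with them.
  have hfin : {p : Nat.Primes | ∃ s ∈ S, ((p : ℕ) ^ k : ℤ) ∣ x₀ + s 0}.Finite := by
    have : {p : Nat.Primes | ∃ s ∈ S, ((p : ℕ) ^ k : ℤ) ∣ x₀ + s 0} =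
        ⋃ s ∈ S, {p : Nat.Primes | ((p : ℕ) ^ k : ℤ) ∣ x₀ + s 0} := by ext; simp
    rw [this]
    refine Set.Finite.biUnion S.finite_toSet fun s hs => finite_setOf_pow_dvd hk ?_
    linarith [hB s hs]
  have hb : ∀ p : Nat.Primes, p ∉ F →
      ∃ b : ℤ, ∀ s ∈ S, ¬ ((p : ℕ) ^ k : ℤ) ∣ b + s 1 := by
    intro p hp
    have hlt : S.card < (p : ℕ) ^ k := by
      by_contra! hle
      exact hp (hF p ((Nat.le_self_pow hk _).trans hle))
    obtain ⟨b, hb⟩ := exists_forall_not_dvd_add (S.image fun s => s 1) ((p : ℕ) ^ k)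
      (Finset.card_image_le.trans_lt hlt)
    refine ⟨b, fun s hs h => hb (s 1) (Finset.mem_image_of_mem (fun s => s 1) hs) ?_⟩
    exact_mod_cast h
  choose! b hb using hb
  -- At primes of `F` the prescribed residue is kept; at the dangerous primes outside `F`, the
  -- residue `b p` avoids all `-s 1`.
  obtain ⟨x₁, hx₁⟩ := exists_forall_pow_dvd_sub k (F ∪ hfin.toFinset)
    fun p => if p ∈ F then c p 1 else b p
  obtain ⟨x, hx⟩ := exists_forall_sub_mem_powSublattice k (n + 2) F c
  set y : Fin (n + 2) → ℤ := Function.update (Function.update x 1 x₁) 0 x₀ with hy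
  have hy0 : y 0 = x₀ := by simp [hy]
  have hy1 : y 1 = x₁ := by simp [hy]
  have hres : ∀ p ∈ F, y - c p ∈ powSublattice k (n + 2) p := by
    intro p hp
    refine mem_powSublattice.2 fun i => ?_
    rw [Pi.sub_apply]
    by_cases h0 : i = 0
    · subst h0
      rw [hy0]
      exact hx₀F p hp
    by_cases h1 : i = 1
    · subst h1
      rw [hy1]
      simpa [hp] using hx₁ p (Finset.mem_union_left _ hp)
    · rw [hy, Function.update_of_ne h0, Function.update_of_ne h1]
      exact mem_powSublattice.1 (hx p hp) i
  refine ⟨y, hres, fun s hs => mem_kFree.2 fun p => ?_⟩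
  by_cases hp : p ∈ F
  · rw [add_mem_powSublattice_iff (hres p hp)]
    exact hc p hp s hs
  · intro h
    rw [mem_powSublattice] at h
    have h0 := h 0
    have h1 := h 1
    rw [Pi.add_apply, hy0] at h0
    rw [Pi.add_apply, hy1] at h1
    have h2 := hx₁ p (Finset.mem_union_right _ (hfin.mem_toFinset.2 ⟨s, hs, h0⟩))
    rw [if_neg hp] at h2
    refine hb p hp s hs ?_
    have h3 := dvd_sub h1 h2
    rwa [show x₁ + s 1 - (x₁ - b p) = b p + s 1 by ring] at h3

/-- A finite set `S` has a `k`-free translate with prescribed residues modulo `p ^ k` for finitely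
many primes `p`, provided that these residues are admissible and all small primes are included. -/
lemma exists_translate_kFree (k n : ℕ) (hnk : 1 < n * k) (S : Finset (Fin n → ℤ)) :
    ∃ P : ℕ, ∀ (F : Finset Nat.Primes) (c : Nat.Primes → Fin n → ℤ),
      (∀ p : Nat.Primes, (p : ℕ) ≤ P → p ∈ F) →
      (∀ p ∈ F, ∀ s ∈ S, c p + s ∉ powSublattice k n p) →
      ∃ x : Fin n → ℤ, (∀ p ∈ F, x - c p ∈ powSublattice k n p) ∧
        ∀ s ∈ S, x + s ∈ kFree k n := by
  -- The hypothesis `1 < n * k` rules out `n = 0` and forces `k ≥ 2` when `n = 1`.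
  match n, S with
  | 0, _ => omega
  | 1, S => exact exists_translate_kFree_one k (by omega) S
  | n + 2, S => exact exists_translate_kFree_add_two k n (by rintro rfl; simp at hnk) S

lemma starMap_apply {k n : ℕ} (x : Fin n → ℤ) (p : Nat.Primes) :
    starMap k n x p = (x : Residue k n p) := rfl

lemma mem_kFreeWindow {k n : ℕ} {h : Internal k n} :
    h ∈ kFreeWindow k n ↔ ∀ p, h p ≠ 0 := by
  simp [kFreeWindow]

lemma starMap_mem_kFreeWindow {k n : ℕ} {x : Fin n → ℤ} :
    starMap k n x ∈ kFreeWindow k n ↔ x ∈ kFree k n := by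
  rw [mem_kFreeWindow, mem_kFree]
  refine forall_congr' fun p => not_congr ?_
  rw [starMap_apply]
  exact QuotientAddGroup.eq_zero_iff x

/-- Every subset of the pattern `{a ∈ A | h + a⋆ ∈ W}` seen from a point `h` of `H` occurs as a
pattern of the `k`-free points. -/
lemma exists_forall_add_mem_kFree_iff {k n : ℕ} (hnk : 1 < n * k) (A S : Finset (Fin n → ℤ))
    (h : Internal k n) (hS : ∀ s ∈ S, h + starMap k n s ∈ kFreeWindow k n) :
    ∃ x : Fin n → ℤ, ∀ a ∈ A, x + a ∈ kFree k n ↔ a ∈ S := by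
  classical
  have hk : k ≠ 0 := by rintro rfl; simp at hnk
  obtain ⟨P, hP⟩ := exists_translate_kFree k n hnk S
  set B := A \ S with hB
  -- distinct large primes, one for each point of `A \ S`
  set T : Set Nat.Primes := {p | (p : ℕ) ≤ P} ∪
    ⋃ a ∈ B, ⋃ s ∈ S, {p | s - a ∈ powSublattice k n p} with hT
  have hTfin : T.Finite := by
    refine (finite_setOf_primes_le P).union (B.finite_toSet.biUnion fun a ha =>
      S.finite_toSet.biUnion fun s hs => finite_setOf_mem_powSublattice hk ?_)
    rw [sub_ne_zero]
    rintro rfl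
    exact (Finset.mem_sdiff.1 ha).2 hs
  have hTinf : Tᶜ.Infinite := hTfin.infinite_compl
  set e : (Fin n → ℤ) → Nat.Primes := fun a => hTinf.natEmbedding _ (Encodable.encode a) with he
  have heT : ∀ a, e a ∉ T := fun a => (hTinf.natEmbedding _ (Encodable.encode a)).2
  have heinj : Function.Injective e := Subtype.val_injective.comp
    ((hTinf.natEmbedding _).injective.comp Encodable.encode_injective)
  -- At the prime `e a` the residue `-a` puts `x + a` into `p^k ℤⁿ`; it is admissible for `S` since
  -- `e a ∉ T` means that no `s - a` lies there. At other primes a lift of `h p` is admissible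
  -- because `h + s⋆ ∈ W`.
  set c : Nat.Primes → Fin n → ℤ := fun p =>
    if p ∈ B.image e then -Function.invFun e p else (h p).out with hc
  have hce : ∀ a ∈ B, c (e a) = -a := by
    intro a ha
    simp only [hc, if_pos (Finset.mem_image_of_mem e ha), Function.leftInverse_invFun heinj a]
  obtain ⟨x, hxF, hxS⟩ := hP ((finite_setOf_primes_le P).toFinset ∪ B.image e) c
    (fun p hp => Finset.mem_union_left _ (by simpa using hp)) (by
      intro p _ s hs
      by_cases hp : p ∈ B.image e
      · obtain ⟨a, ha, rfl⟩ := Finset.mem_image.1 hp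
        rw [hce a ha, neg_add_eq_sub]
        intro hmem
        refine heT a (Or.inr ?_)
        simp only [Set.mem_iUnion]
        exact ⟨a, ha, s, hs, hmem⟩
      · have h1 := mem_kFreeWindow.1 (hS s hs) p
        simp only [hc, if_neg hp]
        rw [← QuotientAddGroup.eq_zero_iff, QuotientAddGroup.mk_add]
        rwa [QuotientAddGroup.out_eq'])
  refine ⟨x, fun a ha => ⟨fun hxa => ?_, fun haS => hxS a haS⟩⟩
  by_contra haS
  have haB : a ∈ B := Finset.mem_sdiff.2 ⟨ha, haS⟩
  have h1 := hxF (e a) (Finset.mem_union_right _ (Finset.mem_image_of_mem e haB))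
  rw [hce a haB, sub_neg_eq_add] at h1
  exact mem_kFree.1 hxa (e a) h1

/-! ### The internal space and its measure -/

instance (k n : ℕ) : IsProbabilityMeasure (internalHaar k n) := by
  unfold internalHaar; infer_instance

lemma isClosed_kFreeWindow (k n : ℕ) : IsClosed (kFreeWindow k n) :=
  isClosed_set_pi fun _ _ => isClosed_discrete _

/-- Every non-empty open subset of `H` contains a basic cylinder set. -/
lemma exists_pi_subset_of_isOpen {k n : ℕ} {U : Set (Internal k n)} (hU : IsOpen U)
    {h : Internal k n} (hh : h ∈ U) :
    ∃ F : Finset Nat.Primes, (F : Set Nat.Primes).pi (fun p => {h p}) ⊆ U := by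
  obtain ⟨F, u, hu, hsub⟩ := isOpen_pi_iff.1 hU h hh
  refine ⟨F, (Set.pi_mono fun p hp => ?_).trans hsub⟩
  rw [Set.singleton_subset_iff]
  exact (hu p hp).2

/-- A cylinder constrains finitely many coordinates only; setting a free coordinate to `0` leaves
the window. -/
lemma interior_kFreeWindow (k n : ℕ) : interior (kFreeWindow k n) = ∅ := by
  classical
  rw [Set.eq_empty_iff_forall_notMem]
  intro h hh
  obtain ⟨F, hF⟩ := exists_pi_subset_of_isOpen isOpen_interior hh
  obtain ⟨p, hp⟩ := F.exists_notMem
  have h1 : Function.update h p 0 ∈ kFreeWindow k n := by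
    refine interior_subset (hF fun q hq => ?_)
    rw [Function.update_of_ne (by rintro rfl; exact hp hq)]
    rfl
  exact mem_kFreeWindow.1 h1 p (Function.update_self _ _ _)

lemma frontier_kFreeWindow (k n : ℕ) : frontier (kFreeWindow k n) = kFreeWindow k n := by
  rw [(isClosed_kFreeWindow k n).frontier_eq, interior_kFreeWindow, Set.sdiff_empty]

lemma interior_compl_kFreeWindow_nonempty (k n : ℕ) : (interior (kFreeWindow k n)ᶜ).Nonempty := by
  rw [(isClosed_kFreeWindow k n).isOpen_compl.interior_eq]
  exact ⟨0, fun h => mem_kFreeWindow.1 h ⟨2, Nat.prime_two⟩ rfl⟩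

lemma denseRange_starMap (k n : ℕ) : DenseRange (starMap k n) := by
  refine dense_iff_inter_open.2 fun U hU ⟨h, hh⟩ => ?_
  obtain ⟨F, hF⟩ := exists_pi_subset_of_isOpen hU hh
  obtain ⟨x, hx⟩ := exists_forall_sub_mem_powSublattice k n F fun p => (h p).out
  refine ⟨starMap k n x, hF fun p hp => ?_, x, rfl⟩
  have h1 := (QuotientAddGroup.eq_zero_iff _).2 (hx p hp)
  rw [QuotientAddGroup.mk_sub, sub_eq_zero, QuotientAddGroup.out_eq'] at h1
  exact h1

lemma mem_diagonalLattice {k n : ℕ} {x : (Fin n → ℤ) × Internal k n} :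
    x ∈ diagonalLattice k n ↔ x.2 = starMap k n x.1 := by
  constructor
  · rintro ⟨y, rfl⟩
    rfl
  · intro h
    exact ⟨x.1, Prod.ext rfl h.symm⟩

lemma mem_projectionSet_diagonalLattice {k n : ℕ} {W : Set (Internal k n)} {x : Fin n → ℤ} :
    x ∈ projectionSet (diagonalLattice k n) W ↔ starMap k n x ∈ W := by
  simp [projectionSet, mem_diagonalLattice]

/-- The lattice is the graph of the star map. It is discrete because it projects injectively to the
discrete group `ℤⁿ`, and cocompact because every coset meets the compact set `{0} × H`. -/
lemma isCutAndProjectScheme_diagonalLattice (k n : ℕ) :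
    IsCutAndProjectScheme (Fin n → ℤ) (Internal k n) (diagonalLattice k n) where
  isTopologicalAddGroup_direct := inferInstance
  t2Space_direct := inferInstance
  locallyCompactSpace_direct := inferInstance
  sigmaCompactSpace_direct := inferInstance
  isTopologicalAddGroup_internal := inferInstance
  t2Space_internal := inferInstance
  locallyCompactSpace_internal := inferInstance
  sigmaCompactSpace_internal := inferInstance
  discrete := by
    refine DiscreteTopology.of_continuous_injective (β := Fin n → ℤ)
      (f := fun y : diagonalLattice k n => (y : (Fin n → ℤ) × Internal k n).1)
      (continuous_fst.comp continuous_subtype_val) ?_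
    rintro ⟨y, hy⟩ ⟨z, hz⟩ (h : y.1 = z.1)
    rw [mem_diagonalLattice] at hy hz
    exact Subtype.ext (Prod.ext h (by rw [hy, hz, h]))
  cocompact := by
    have hc : IsCompact (Set.range fun h : Internal k n =>
        (((0, h) : (Fin n → ℤ) × Internal k n) :
          ((Fin n → ℤ) × Internal k n) ⧸ diagonalLattice k n)) :=
      isCompact_range (continuous_quot_mk.comp (by fun_prop))
    refine ⟨?_⟩
    convert hc
    refine (Set.eq_univ_iff_forall.2 fun q => ?_).symm
    induction q using QuotientAddGroup.induction_on with
    | H z =>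
      refine ⟨z.2 - starMap k n z.1, QuotientAddGroup.eq.2 ?_⟩
      rw [mem_diagonalLattice]
      simp
  injOn_fst := by
    intro y hy z hz h
    rw [SetLike.mem_coe, mem_diagonalLattice] at hy hz
    exact Prod.ext h (by rw [hy, hz, h])
  dense_snd := by
    have h : Prod.snd '' (diagonalLattice k n : Set ((Fin n → ℤ) × Internal k n)) =
        Set.range (starMap k n) := by
      ext h
      simp [mem_diagonalLattice, eq_comm]
    rw [h]
    exact denseRange_starMap k n

lemma card_residue (k n : ℕ) (p : Nat.Primes) :
    Nat.card (Residue k n p) = (p : ℕ) ^ (n * k) := by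
  have : NeZero ((p : ℕ) ^ k) := ⟨pow_ne_zero _ p.2.ne_zero⟩
  let f : (Fin n → ℤ) →+ (Fin n → ZMod ((p : ℕ) ^ k)) :=
    (Int.castAddHom (ZMod ((p : ℕ) ^ k))).compLeft (Fin n)
  have hf : f.ker = powSublattice k n p := by
    ext x
    rw [mem_powSublattice, AddMonoidHom.mem_ker, funext_iff]
    refine forall_congr' fun i => ?_
    have := ZMod.intCast_zmod_eq_zero_iff_dvd (x i) ((p : ℕ) ^ k)
    simpa [f] using this
  have hsurj : Function.Surjective f := by
    intro y
    choose x hx using fun i => ZMod.intCast_surjective (y i)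
    exact ⟨x, funext hx⟩
  have h1 := Nat.card_congr (QuotientAddGroup.quotientKerEquivOfSurjective f hsurj).toEquiv
  rw [hf] at h1
  rw [h1, Nat.card_fun, Nat.card_zmod, Nat.card_fin, ← pow_mul, mul_comm]

lemma uniformOn_singleton (k n : ℕ) (p : Nat.Primes) (x : Residue k n p) :
    ProbabilityTheory.uniformOn (Set.univ : Set (Residue k n p)) {x} =
      ((p : ENNReal) ^ (n * k))⁻¹ := by
  have := Fintype.ofFinite (Residue k n p)
  rw [ProbabilityTheory.uniformOn_univ, Measure.count_singleton, ← Nat.card_eq_fintype_card,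
    card_residue]
  simp

lemma uniformOn_map_add (k n : ℕ) (p : Nat.Primes) (a : Residue k n p) :
    (ProbabilityTheory.uniformOn (Set.univ : Set (Residue k n p))).map (a + ·) =
      ProbabilityTheory.uniformOn Set.univ := by
  refine Measure.ext_of_singleton fun x => ?_
  rw [Measure.map_apply (measurable_of_finite _) (measurableSet_singleton _)]
  have : (a + ·) ⁻¹' {x} = {x - a} := by
    ext y
    rw [Set.mem_preimage, Set.mem_singleton_iff, Set.mem_singleton_iff, eq_sub_iff_add_eq']
  rw [this, uniformOn_singleton, uniformOn_singleton]

instance (k n : ℕ) (p : Nat.Primes) : BorelSpace (Residue k n p) :=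
  inferInstance

instance (k n : ℕ) : BorelSpace (Internal k n) :=
  inferInstance

instance (k n : ℕ) : (internalHaar k n).IsAddLeftInvariant := by
  refine ⟨fun g => ?_⟩
  have h := Measure.infinitePi_map_pi
    (fun p => ProbabilityTheory.uniformOn (Set.univ : Set (Residue k n p)))
    (f := fun p x => g p + x) fun p => measurable_of_finite _
  simp only [uniformOn_map_add] at h
  exact h

instance (k n : ℕ) : (internalHaar k n).IsOpenPosMeasure := by
  refine ⟨fun U hU ⟨h, hh⟩ => ?_⟩
  obtain ⟨F, hF⟩ := exists_pi_subset_of_isOpen hU hh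
  refine (lt_of_lt_of_le ?_ (measure_mono hF)).ne'
  rw [internalHaar, Measure.infinitePi_pi _ fun p _ => measurableSet_singleton _]
  refine pos_iff_ne_zero.2 (Finset.prod_ne_zero_iff.2 fun p _ => ?_)
  rw [uniformOn_singleton]
  simp

instance (k n : ℕ) : (internalHaar k n).IsAddHaarMeasure where

/-- The set `{0} × H` is a fundamental domain of the diagonal lattice. -/
lemma isAddFundamentalDomain_diagonalLattice (k n : ℕ) :
    IsAddFundamentalDomain (diagonalLattice k n) ({0} ×ˢ Set.univ : Set ((Fin n → ℤ) × Internal k n))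
      (Measure.count.prod (internalHaar k n)) := by
  refine IsAddFundamentalDomain.mk' ?_ ?_
  · exact ((measurableSet_singleton _).prod MeasurableSet.univ).nullMeasurableSet
  · intro z
    refine ⟨⟨(-z.1, starMap k n (-z.1)), mem_diagonalLattice.2 rfl⟩, ?_, ?_⟩
    · simp [AddSubgroup.vadd_def]
    · rintro ⟨y, hy⟩ h
      rw [mem_diagonalLattice] at hy
      have h1 : y.1 = -z.1 := by
        simpa [AddSubgroup.vadd_def, eq_neg_iff_add_eq_zero] using h
      exact Subtype.ext (Prod.ext h1 (by rw [hy, h1]))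

lemma latticeDensity_diagonalLattice (k n : ℕ) :
    latticeDensity (diagonalLattice k n) Measure.count (internalHaar k n) = 1 := by
  have hcount : Countable (diagonalLattice k n) := by
    refine (Set.countable_range fun x : Fin n → ℤ => (x, starMap k n x)).mono fun y hy => ?_
    exact ⟨y.1, Prod.ext rfl (mem_diagonalLattice.1 hy).symm⟩
  rw [latticeDensity, (isAddFundamentalDomain_diagonalLattice k n).covolume_eq_volume,
    Measure.prod_prod, Measure.count_singleton, measure_univ]
  simp

/-! ### The measure of the window -/

lemma uniformOn_real_compl_zero (k n : ℕ) (p : Nat.Primes) :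
    (ProbabilityTheory.uniformOn (Set.univ : Set (Residue k n p))).real {0}ᶜ =
      1 - ((p : ℝ) ^ (n * k))⁻¹ := by
  rw [probReal_compl_eq_one_sub (measurableSet_singleton _), Measure.real, uniformOn_singleton]
  simp

/-- The window is the decreasing intersection of the cylinders with non-zero coordinates in `F`,
whose measures are the partial products; continuity from above gives the limit. It yields both the
value `1/ζ(nk)` and the final step of the upper entropy bound. -/
lemma tendsto_prod_internalHaar_kFreeWindow (k n : ℕ) :
    Tendsto (fun F : Finset Nat.Primes => ∏ p ∈ F, (1 - ((p : ℝ) ^ (n * k))⁻¹)) atTop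
      (𝓝 ((internalHaar k n).real (kFreeWindow k n))) := by
  have h1 : ∀ F : Finset Nat.Primes, ∏ p ∈ F, (1 - ((p : ℝ) ^ (n * k))⁻¹) =
      (internalHaar k n).real ((F : Set Nat.Primes).pi fun _ => {0}ᶜ) := by
    intro F
    rw [Measure.real, internalHaar, Measure.infinitePi_pi _ fun p _ =>
      (measurableSet_singleton _).compl, ENNReal.toReal_prod]
    exact Finset.prod_congr rfl fun p _ => (uniformOn_real_compl_zero k n p).symm
  have h2 : kFreeWindow k n =
      ⋂ F : Finset Nat.Primes, (F : Set Nat.Primes).pi fun _ => ({0}ᶜ : Set (Residue k n _)) := by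
    ext h
    simp only [mem_kFreeWindow, Set.mem_iInter, Set.mem_pi]
    exact ⟨fun H F p _ => H p, fun H p => H {p} p (by simp)⟩
  simp only [h1]
  refine (ENNReal.tendsto_toReal (measure_ne_top _ _)).comp ?_
  rw [h2]
  refine tendsto_measure_iInter_atTop (fun F => ?_) ?_ ⟨∅, measure_ne_top _ _⟩
  · exact (MeasurableSet.pi F.countable_toSet fun p _ =>
      (measurableSet_singleton _).compl).nullMeasurableSet
  · exact fun F F' hF => Set.pi_mono' (fun _ _ => subset_rfl) (Finset.coe_subset.2 hF)

lemma internalHaar_real_kFreeWindow (k n : ℕ) (hnk : 1 < n * k) :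
    ((internalHaar k n).real (kFreeWindow k n) : ℂ) = 1 / riemannZeta ((n * k : ℕ) : ℂ) := by
  have hs : 1 < (((n * k : ℕ) : ℂ)).re := by simpa using (by exact_mod_cast hnk : (1 : ℝ) < n * k)
  have h1 := (riemannZeta_eulerProduct_hasProd hs)
  have h2 := h1.inv₀ (riemannZeta_ne_zero_of_one_lt_re hs)
  have h3 := (Complex.continuous_ofReal.tendsto _).comp (tendsto_prod_internalHaar_kFreeWindow k n)
  rw [one_div]
  refine tendsto_nhds_unique h3 (h2.congr fun F => ?_)
  simp only [Function.comp_apply]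
  push_cast
  refine Finset.prod_congr rfl fun p _ => ?_
  rw [inv_inv, Complex.cpow_neg]
  norm_cast

lemma internalHaar_real_kFreeWindow_pos (k n : ℕ) (hnk : 1 < n * k) :
    0 < (internalHaar k n).real (kFreeWindow k n) := by
  refine lt_of_le_of_ne measureReal_nonneg fun h => ?_
  have h1 := internalHaar_real_kFreeWindow k n hnk
  rw [← h, Complex.ofReal_zero, eq_comm, one_div, inv_eq_zero] at h1
  refine riemannZeta_ne_zero_of_one_lt_re ?_ h1
  simpa using (by exact_mod_cast hnk : (1 : ℝ) < n * k)

/-! ### Complexity of coloured patterns -/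

section Complexity

variable {G : Type*} [AddCommGroup G]

/-- For `D₀ = G` the first component of a pattern is always `A` and carries no information. -/
lemma colouredComplexity_univ (A D : Set G) :
    colouredComplexity A D Set.univ = (Set.range fun x : G => {a | x + a ∈ D} ∩ A).ncard := by
  have h : colouredPatterns A D Set.univ =
      Prod.mk A '' Set.range fun x : G => {a | x + a ∈ D} ∩ A := by
    rw [colouredPatterns, Set.image_univ, ← Set.range_comp]
    simp [Function.comp_def]
  rw [colouredComplexity, h, Set.ncard_image_of_injective _ (Prod.mk_right_injective A)]

lemma colouredComplexity_compl_univ (A D : Set G) :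
    colouredComplexity A Dᶜ Set.univ = colouredComplexity A D Set.univ := by
  have h : (Set.range fun x : G => {a | x + a ∈ Dᶜ} ∩ A) =
      (A \ ·) '' Set.range fun x : G => {a | x + a ∈ D} ∩ A := by
    rw [← Set.range_comp]
    congr 1
    ext x a
    simp only [Function.comp_apply, Set.mem_inter_iff, Set.mem_ofPred_eq, Set.mem_compl_iff,
      Set.mem_sdiff]
    tauto
  rw [colouredComplexity_univ, colouredComplexity_univ, h]
  refine Set.InjOn.ncard_image ?_
  rintro _ ⟨x, rfl⟩ _ ⟨y, rfl⟩ hxy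
  have := congrArg (A \ ·) hxy
  simpa [Set.inter_comm] using this

lemma colouredPatternEntropy_compl_univ [MeasurableSpace G] (θ : Measure G) (A : ℕ → Set G)
    (D : Set G) :
    colouredPatternEntropy θ A Dᶜ Set.univ = colouredPatternEntropy θ A D Set.univ := by
  simp only [colouredPatternEntropy, colouredComplexity_compl_univ]

lemma finite_range_pattern (A : Finset G) (D : Set G) :
    (Set.range fun x : G => {a | x + a ∈ D} ∩ (A : Set G)).Finite := by
  refine A.finite_toSet.finite_subsets.subset ?_
  rintro _ ⟨x, rfl⟩
  exact Set.inter_subset_right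

lemma colouredComplexity_pos (A : Finset G) (D : Set G) :
    0 < colouredComplexity (A : Set G) D Set.univ := by
  rw [colouredComplexity_univ, Set.ncard_pos (finite_range_pattern A D)]
  exact Set.range_nonempty _

lemma two_pow_card_le_colouredComplexity (A S : Finset G) (D : Set G) (hSA : S ⊆ A)
    (h : ∀ T ⊆ S, ∃ x : G, ∀ a ∈ A, x + a ∈ D ↔ a ∈ T) :
    2 ^ S.card ≤ colouredComplexity (A : Set G) D Set.univ := by
  rw [← Finset.card_powerset, ← Set.ncard_coe_finset,
    ← Set.ncard_image_of_injective _ (Finset.coe_injective (α := G)), colouredComplexity_univ]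
  refine Set.ncard_le_ncard ?_ (finite_range_pattern A D)
  rintro _ ⟨T, hT, rfl⟩
  have hTS : T ⊆ S := Finset.mem_powerset.1 hT
  obtain ⟨x, hx⟩ := h T hTS
  refine ⟨x, ?_⟩
  ext a
  simp only [Set.mem_inter_iff, Set.mem_ofPred_eq, Finset.mem_coe]
  exact ⟨fun ha => (hx a ha.2).1 ha.1, fun ha => ⟨(hx a (hSA (hTS ha))).2 ha, hSA (hTS ha)⟩⟩

/-! ### Upper bound for the complexity through a finite quotient -/

variable {Q : Type*} [AddCommGroup Q] [Fintype Q] [DecidableEq Q]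

/-- If `D` lies in the preimage of a subset `U` of a finite quotient `Q`, the patterns of `D` lie in
`|Q|` power sets. -/
lemma colouredComplexity_le_sum (φ : G →+ Q) (U : Finset Q) (A : Finset G) (D : Set G)
    (hD : ∀ x ∈ D, φ x ∈ U) :
    colouredComplexity (A : Set G) D Set.univ ≤
      ∑ q : Q, 2 ^ (A.filter fun a => q + φ a ∈ U).card := by
  classical
  have hsub : (Set.range fun x : G => {a | x + a ∈ D} ∩ (A : Set G)) ⊆
      (↑) '' ((Finset.univ.biUnion fun q : Q => (A.filter fun a => q + φ a ∈ U).powerset :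
        Finset (Finset G)) : Set (Finset G)) := by
    rintro _ ⟨x, rfl⟩
    refine ⟨A.filter fun a => x + a ∈ D, ?_, ?_⟩
    · simp only [Finset.coe_biUnion, Set.mem_iUnion, Finset.mem_coe, Finset.mem_powerset]
      refine ⟨φ x, Finset.mem_univ _, fun a ha => ?_⟩
      rw [Finset.mem_filter] at ha ⊢
      exact ⟨ha.1, by simpa using hD _ ha.2⟩
    · ext a
      simp [and_comm]
  rw [colouredComplexity_univ]
  refine (Set.ncard_le_ncard hsub ((Finset.finite_toSet _).image _)).trans ?_
  refine (Set.ncard_image_le (Finset.finite_toSet _)).trans ?_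
  rw [Set.ncard_coe_finset]
  refine Finset.card_biUnion_le.trans (Finset.sum_le_sum fun q _ => ?_)
  rw [Finset.card_powerset]

/-- Equidistribution of a finite set with small boundary in a finite quotient. -/
lemma card_mul_card_filter_le [DecidableEq G] (φ : G →+ Q) (σ : Q → G) (hσ : ∀ q, φ (σ q) = q)
    (U : Finset Q) (A : Finset G) (q : Q) (b : ℕ)
    (hb : ∀ r, (A.filter fun a => a - σ r ∉ A).card ≤ b) :
    Fintype.card Q * (A.filter fun a => q + φ a ∈ U).card ≤
      A.card * U.card + Fintype.card Q * b := by
  -- For fixed `a`, the map `r ↦ q + r + φ a` is a bijection of `Q`, so `a` is counted `|U|` times.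
  have hsum : ∑ r : Q, (A.filter fun a => (q + r) + φ a ∈ U).card = A.card * U.card := by
    simp only [Finset.card_filter]
    rw [Finset.sum_comm]
    have : ∀ a ∈ A, (∑ r : Q, if q + r + φ a ∈ U then 1 else 0) = U.card := by
      intro a _
      rw [← Finset.card_filter]
      refine Finset.card_bij (fun r _ => q + r + φ a) ?_ ?_ ?_
      · simp
      · intro r _ r' _ h
        simpa using h
      · intro u hu
        have hu' : q + (u - q - φ a) + φ a = u := by abel
        exact ⟨u - q - φ a, by simpa [hu'] using hu, hu'⟩
    rw [Finset.sum_congr rfl this]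
    simp
  -- Translation by `-σ r` carries the points counted for `q` to points counted for `q + r`, apart
  -- from the at most `b` points that leave `A`.
  have hstep : ∀ r : Q, (A.filter fun a => q + φ a ∈ U).card ≤
      (A.filter fun a => (q + r) + φ a ∈ U).card + b := by
    intro r
    rw [← Finset.card_filter_add_card_filter_not (s := A.filter fun a => q + φ a ∈ U)
      (fun a => a - σ r ∈ A)]
    refine add_le_add ?_ ((Finset.card_le_card ?_).trans (hb r))
    · refine Finset.card_le_card_of_injOn (· - σ r) ?_ (sub_left_injective.injOn)
      intro a ha
      simp only [Finset.coe_filter, Finset.mem_filter, Set.mem_ofPred_eq] at ha ⊢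
      refine ⟨ha.2, ?_⟩
      rw [map_sub, hσ, show q + r + (φ a - r) = q + φ a by abel]
      exact ha.1.2
    · exact Finset.filter_subset_filter _ (Finset.filter_subset _ _)
  calc Fintype.card Q * (A.filter fun a => q + φ a ∈ U).card
      = ∑ _r : Q, (A.filter fun a => q + φ a ∈ U).card := by simp
    _ ≤ ∑ r : Q, ((A.filter fun a => (q + r) + φ a ∈ U).card + b) :=
        Finset.sum_le_sum fun r _ => hstep r
    _ = _ := by rw [Finset.sum_add_distrib, hsum]; simp

lemma log_colouredComplexity_le [DecidableEq G] (φ : G →+ Q) (σ : Q → G) (hσ : ∀ q, φ (σ q) = q)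
    (U : Finset Q) (A : Finset G) (b : ℕ) (hb : ∀ r, (A.filter fun a => a - σ r ∉ A).card ≤ b)
    (D : Set G) (hD : ∀ x ∈ D, φ x ∈ U) :
    Real.log (colouredComplexity (A : Set G) D Set.univ) ≤
      Real.log (Fintype.card Q) +
        (A.card * ((U.card : ℝ) / Fintype.card Q) + b) * Real.log 2 := by
  have hQ : (0 : ℝ) < Fintype.card Q := by exact_mod_cast Fintype.card_pos
  set t : ℝ := A.card * ((U.card : ℝ) / Fintype.card Q) + b with ht
  have h1 : ∀ q : Q, ((A.filter fun a => q + φ a ∈ U).card : ℝ) ≤ t := by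
    intro q
    have h := card_mul_card_filter_le φ σ hσ U A q b hb
    have h' : (Fintype.card Q : ℝ) * (A.filter fun a => q + φ a ∈ U).card ≤
      A.card * U.card + Fintype.card Q * b := by exact_mod_cast h
    refine le_of_mul_le_mul_left (h'.trans_eq ?_) hQ
    rw [ht]
    field_simp
  have h2 : (colouredComplexity (A : Set G) D Set.univ : ℝ) ≤
      Fintype.card Q * (2 : ℝ) ^ t := by
    calc (colouredComplexity (A : Set G) D Set.univ : ℝ)
        ≤ ∑ q : Q, (2 : ℝ) ^ (A.filter fun a => q + φ a ∈ U).card := by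
          exact_mod_cast colouredComplexity_le_sum φ U A D hD
      _ ≤ ∑ _q : Q, (2 : ℝ) ^ t := by
          refine Finset.sum_le_sum fun q _ => ?_
          rw [← Real.rpow_natCast]
          exact Real.rpow_le_rpow_of_exponent_le one_le_two (h1 q)
      _ = _ := by simp
  have h3 : (0 : ℝ) < colouredComplexity (A : Set G) D Set.univ := by
    exact_mod_cast colouredComplexity_pos A D
  refine (Real.log_le_log h3 h2).trans_eq ?_
  rw [Real.log_mul hQ.ne' (Real.rpow_pos_of_pos two_pos t).ne', Real.log_rpow two_pos]

end Complexity

/-! ### Van Hove sequences in discrete groups -/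

section VanHove

lemma count_real_eq_ncard {α : Type*} [MeasurableSpace α] [MeasurableSingletonClass α] {s : Set α}
    (hs : s.Finite) : Measure.count.real s = s.ncard := by
  rw [Measure.real, Measure.count_apply_finite _ hs, Set.ncard_eq_toFinset_card _ hs]
  simp

lemma IsVanHove.nonempty {G : Type*} [AddCommGroup G] [TopologicalSpace G] [MeasurableSpace G]
    {A : ℕ → Set G} (hA : IsVanHove Measure.count A) (m : ℕ) : (A m).Nonempty :=
  nonempty_of_measure_ne_zero (hA.1 m).2.ne'

variable {G : Type*} [AddCommGroup G] [TopologicalSpace G] [DiscreteTopology G]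

lemma vanHoveBoundary_eq (K A : Set G) :
    vanHoveBoundary K A = ((K + A) ∩ Aᶜ) ∪ ((K + Aᶜ) ∩ A) := by
  simp [vanHoveBoundary]

lemma finite_vanHoveBoundary {K A : Set G} (hK : K.Finite) (hA : A.Finite) :
    (vanHoveBoundary K A).Finite := by
  rw [vanHoveBoundary_eq]
  exact ((hK.add hA).inter_of_left _).union (hA.inter_of_right _)

/-- Without boundary, `A` would be stable under adding `v` and contain the infinite set of all `j •
v + a`. -/
lemma vanHoveBoundary_singleton_nonempty {v : G} (hv : addOrderOf v = 0) {A : Set G}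
    (hA : A.Finite) (hne : A.Nonempty) : (vanHoveBoundary {v} A).Nonempty := by
  by_contra H
  rw [Set.not_nonempty_iff_eq_empty, vanHoveBoundary_eq, Set.union_empty_iff] at H
  obtain ⟨a, ha⟩ := hne
  have hstep : ∀ x ∈ A, v + x ∈ A := by
    intro x hx
    by_contra hx'
    exact Set.notMem_empty (v + x) (H.1 ▸ ⟨Set.add_mem_add rfl hx, hx'⟩)
  have hall : ∀ j : ℕ, j • v + a ∈ A := by
    intro j
    induction j with
    | zero => simpa using ha
    | succ j ih =>
      rw [succ_nsmul', add_assoc]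
      exact hstep _ ih
  refine Set.infinite_of_injective_forall_mem (f := fun j : ℕ => j • v + a) ?_ hall hA
  intro i j hij
  exact injective_nsmul_iff_not_isOfFinAddOrder.2 (addOrderOf_eq_zero_iff.1 hv)
    (add_right_cancel hij)

variable [MeasurableSpace G] {A : ℕ → Set G}

lemma IsVanHove.finite (hA : IsVanHove Measure.count A) (m : ℕ) : (A m).Finite :=
  (hA.1 m).1.finite_of_discrete

variable [MeasurableSingletonClass G]

lemma IsVanHove.tendsto_ncard_div (hA : IsVanHove Measure.count A) {K : Set G} (hK : K.Finite) :
    Tendsto (fun m => ((vanHoveBoundary K (A m)).ncard : ℝ) / (A m).ncard) atTop (𝓝 0) := by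
  have h := (ENNReal.tendsto_toReal ENNReal.zero_ne_top).comp (hA.2 K hK.isCompact)
  rw [ENNReal.toReal_zero] at h
  refine h.congr fun m => ?_
  have hb := finite_vanHoveBoundary hK (hA.finite m)
  rw [Function.comp_apply, ENNReal.toReal_div, Measure.count_apply_finite _ hb,
    Measure.count_apply_finite _ (hA.finite m), Set.ncard_eq_toFinset_card _ hb,
    Set.ncard_eq_toFinset_card _ (hA.finite m)]
  simp

/-- The boundary for `{v}` has at least one point, so `1/|A m|` is at most the boundary ratio. This
makes the additive constant `log |Q|` negligible. -/
lemma IsVanHove.tendsto_inv_ncard (hA : IsVanHove Measure.count A) {v : G}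
    (hv : addOrderOf v = 0) :
    Tendsto (fun m => ((A m).ncard : ℝ)⁻¹) atTop (𝓝 0) := by
  refine squeeze_zero (fun m => by positivity) (fun m => ?_)
    (hA.tendsto_ncard_div (Set.finite_singleton v))
  rw [← one_div]
  have hb := finite_vanHoveBoundary (Set.finite_singleton v) (hA.finite m)
  have h1 := (Set.ncard_pos hb).2
    (vanHoveBoundary_singleton_nonempty hv (hA.finite m) (hA.nonempty m))
  gcongr
  exact_mod_cast h1

end VanHove

/-! ### The entropy of the `k`-free lattice points -/

/-- Averaging over `H`: some pattern of the window has at least the expected number of points. -/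
lemma exists_card_mul_le_card_filter (k n : ℕ) (A : Finset (Fin n → ℤ)) :
    ∃ (h : Internal k n) (S : Finset (Fin n → ℤ)), S ⊆ A ∧
      (∀ s ∈ S, h + starMap k n s ∈ kFreeWindow k n) ∧
      A.card * (internalHaar k n).real (kFreeWindow k n) ≤ S.card := by
  classical
  have hmeas : ∀ a : Fin n → ℤ,
      MeasurableSet ((· + starMap k n a) ⁻¹' kFreeWindow k n) := fun a =>
    ((isClosed_kFreeWindow k n).preimage (by fun_prop)).measurableSet
  have hint : ∀ a ∈ A, Integrable
      (((· + starMap k n a) ⁻¹' kFreeWindow k n).indicator fun _ => (1 : ℝ))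
      (internalHaar k n) := fun a _ => (integrable_const 1).indicator (hmeas a)
  -- Some `h` does at least as well as the mean; by invariance each `a ∈ A` contributes `θ_H(W)` to
  -- that mean.
  obtain ⟨h, hh⟩ := exists_integral_le (integrable_finsetSum A hint)
  rw [integral_finsetSum A hint] at hh
  refine ⟨h, A.filter fun a => h + starMap k n a ∈ kFreeWindow k n, Finset.filter_subset _ _,
    fun s hs => (Finset.mem_filter.1 hs).2, ?_⟩
  have h1 : ∀ a ∈ A, ∫ y, ((· + starMap k n a) ⁻¹' kFreeWindow k n).indicator
      (fun _ => (1 : ℝ)) y ∂(internalHaar k n) = (internalHaar k n).real (kFreeWindow k n) := by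
    intro a _
    rw [integral_indicator_const _ (hmeas a), Measure.real, measure_preimage_add_right]
    simp [Measure.real]
  rw [Finset.sum_congr rfl h1, Finset.sum_const, nsmul_eq_mul] at hh
  refine hh.trans_eq ?_
  rw [Finset.card_filter]
  push_cast
  refine Finset.sum_congr rfl fun a _ => ?_
  simp [Set.indicator_apply]

lemma card_mul_log_two_le_log_colouredComplexity {k n : ℕ} (hnk : 1 < n * k)
    (A : Finset (Fin n → ℤ)) :
    A.card * ((internalHaar k n).real (kFreeWindow k n) * Real.log 2) ≤
      Real.log (colouredComplexity (A : Set (Fin n → ℤ)) (kFree k n) Set.univ) := by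
  obtain ⟨h, S, hSA, hS, hcard⟩ := exists_card_mul_le_card_filter k n A
  have h1 := two_pow_card_le_colouredComplexity A S (kFree k n) hSA fun T hT =>
    exists_forall_add_mem_kFree_iff hnk A T h fun s hs => hS s (hT hs)
  have h2 : (2 : ℝ) ^ S.card ≤
      colouredComplexity (A : Set (Fin n → ℤ)) (kFree k n) Set.univ := by exact_mod_cast h1
  calc _ = A.card * (internalHaar k n).real (kFreeWindow k n) * Real.log 2 := by ring
    _ ≤ S.card * Real.log 2 := by
        gcongr
    _ = Real.log ((2 : ℝ) ^ S.card) := (Real.log_pow _ _).symm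
    _ ≤ _ := Real.log_le_log (by positivity) h2

/-- The reduction of `ℤⁿ` modulo `p ^ k` for `p` in a finite set of primes. -/
def finiteStarMap (k n : ℕ) (F : Finset Nat.Primes) :
    (Fin n → ℤ) →+ ((p : F) → Residue k n p) :=
  AddMonoidHom.pi fun p => QuotientAddGroup.mk' (powSublattice k n p)

lemma finiteStarMap_apply {k n : ℕ} (F : Finset Nat.Primes) (x : Fin n → ℤ) (p : F) :
    finiteStarMap k n F x p = (x : Residue k n p) := rfl

lemma finiteStarMap_surjective (k n : ℕ) (F : Finset Nat.Primes) :
    Function.Surjective (finiteStarMap k n F) := by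
  classical
  intro q
  obtain ⟨x, hx⟩ := exists_forall_sub_mem_powSublattice k n F fun p =>
    if hp : p ∈ F then (q ⟨p, hp⟩).out else 0
  refine ⟨x, funext fun ⟨p, hp⟩ => ?_⟩
  have h1 := (QuotientAddGroup.eq_zero_iff _).2 (hx p hp)
  rw [dif_pos hp, QuotientAddGroup.mk_sub, sub_eq_zero, QuotientAddGroup.out_eq'] at h1
  exact h1

/-- The quotient bound is applied to `∏_{p ∈ F} ℤⁿ/p^k ℤⁿ`, with `U` the tuples without zero
coordinate; the density of `U` is the truncated Euler product. `K` is a set of coset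
representatives, and `C` and `K` depend on `F` but not on `A`. -/
lemma exists_log_colouredComplexity_le (k n : ℕ) (F : Finset Nat.Primes) :
    ∃ (C : ℝ) (K : Set (Fin n → ℤ)), K.Finite ∧ ∀ A : Finset (Fin n → ℤ),
      Real.log (colouredComplexity (A : Set (Fin n → ℤ)) (kFree k n) Set.univ) ≤
        C + (A.card * ∏ p ∈ F, (1 - ((p : ℝ) ^ (n * k))⁻¹) +
          (vanHoveBoundary K (A : Set (Fin n → ℤ))).ncard) * Real.log 2 := by
  classical
  have hfin : ∀ p : F, Fintype (Residue k n p) := fun p => Fintype.ofFinite _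
  set σ := Function.surjInv (finiteStarMap_surjective k n F) with hσ
  set U : Finset ((p : F) → Residue k n p) := Fintype.piFinset fun p => {0}ᶜ with hU
  have hcard : ∀ p : F, Fintype.card (Residue k n p) = ((p : Nat.Primes) : ℕ) ^ (n * k) := by
    intro p
    rw [← Nat.card_eq_fintype_card, card_residue]
  have hdens : (U.card : ℝ) / Fintype.card ((p : F) → Residue k n p) =
      ∏ p ∈ F, (1 - ((p : ℝ) ^ (n * k))⁻¹) := by
    rw [hU, Fintype.card_piFinset, Fintype.card_pi]
    push_cast
    rw [← Finset.prod_div_distrib, ← Finset.prod_coe_sort F]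
    refine Finset.prod_congr rfl fun p _ => ?_
    have hp : (0 : ℝ) < (((p : Nat.Primes) : ℕ) : ℝ) ^ (n * k) :=
      pow_pos (by exact_mod_cast (p : Nat.Primes).2.pos) _
    rw [Finset.card_compl, Finset.card_singleton, hcard,
      Nat.cast_sub (Nat.one_le_pow _ _ (p : Nat.Primes).2.pos)]
    push_cast
    rw [sub_div, div_self hp.ne', one_div]
  refine ⟨Real.log (Fintype.card ((p : F) → Residue k n p)), Set.range σ, Set.finite_range σ,
    fun A => ?_⟩
  rw [← hdens]
  refine log_colouredComplexity_le (finiteStarMap k n F) σ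
    (Function.surjInv_eq (finiteStarMap_surjective k n F)) U A _ (fun r => ?_) _ fun x hx => ?_
  · rw [← Set.ncard_coe_finset]
    refine Set.ncard_le_ncard ?_
      (finite_vanHoveBoundary (Set.finite_range σ) A.finite_toSet)
    intro a ha
    obtain ⟨haA, haσ⟩ := Finset.mem_filter.1 (Finset.mem_coe.1 ha)
    rw [vanHoveBoundary_eq]
    -- Writing `a = σ r + (a - σ r)` with `a - σ r ∉ A` puts `a` in the inner part of the boundary.
    refine Or.inr ⟨⟨σ r, ⟨r, rfl⟩, a - σ r, ?_, by simp⟩, haA⟩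
    simpa using haσ
  · rw [hU, Fintype.mem_piFinset]
    intro p
    rw [Finset.mem_compl, Finset.mem_singleton, finiteStarMap_apply]
    exact fun h => mem_kFree.1 hx p ((QuotientAddGroup.eq_zero_iff x).1 h)

lemma addOrderOf_one_eq_zero {n : ℕ} (hn : n ≠ 0) : addOrderOf (1 : Fin n → ℤ) = 0 := by
  rw [addOrderOf_eq_zero_iff, isOfFinAddOrder_iff_nsmul_eq_zero]
  rintro ⟨j, hj, h⟩
  have := congrFun h ⟨0, Nat.pos_of_ne_zero hn⟩
  simp at this
  omega

/-- The lower bound holds for each `m` separately. For the upper bound, `F` is fixed first, with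
truncated product times `log 2` below `c`, and only then `m → ∞`. So the limsup defining the entropy
is a limit. -/
lemma tendsto_log_colouredComplexity_kFree {k n : ℕ} (hnk : 1 < n * k)
    {A : ℕ → Set (Fin n → ℤ)} (hA : IsVanHove Measure.count A) :
    Tendsto (fun m => Real.log (colouredComplexity (A m) (kFree k n) Set.univ) /
      Measure.count.real (A m)) atTop
      (𝓝 ((internalHaar k n).real (kFreeWindow k n) * Real.log 2)) := by
  have hn : n ≠ 0 := by rintro rfl; simp at hnk
  have hpos : ∀ m, (0 : ℝ) < (A m).ncard := fun m => by
    exact_mod_cast (Set.ncard_pos (hA.finite m)).2 (hA.nonempty m)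
  have hcard : ∀ m, (hA.finite m).toFinset.card = (A m).ncard := fun m =>
    (Set.ncard_eq_toFinset_card _ _).symm
  simp only [fun m => count_real_eq_ncard (hA.finite m)]
  refine tendsto_order.2 ⟨fun c hc => Eventually.of_forall fun m => hc.trans_le ?_,
    fun c hc => ?_⟩
  · rw [le_div_iff₀' (hpos m)]
    have h := card_mul_log_two_le_log_colouredComplexity hnk (hA.finite m).toFinset
    rwa [Set.Finite.coe_toFinset, hcard] at h
  · have hF := ((tendsto_prod_internalHaar_kFreeWindow k n).mul_const
      (Real.log 2)).eventually_lt_const hc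
    obtain ⟨F, hF⟩ := hF.exists
    obtain ⟨C, K, hK, hbound⟩ := exists_log_colouredComplexity_le k n F
    have hlim : Tendsto (fun m => C * ((A m).ncard : ℝ)⁻¹ +
        (∏ p ∈ F, (1 - ((p : ℝ) ^ (n * k))⁻¹) +
          ((vanHoveBoundary K (A m)).ncard : ℝ) / (A m).ncard) * Real.log 2) atTop
        (𝓝 (C * 0 + (∏ p ∈ F, (1 - ((p : ℝ) ^ (n * k))⁻¹) + 0) * Real.log 2)) :=
      ((hA.tendsto_inv_ncard (addOrderOf_one_eq_zero hn)).const_mul C).add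
        (((hA.tendsto_ncard_div hK).const_add _).mul_const _)
    rw [mul_zero, zero_add, add_zero] at hlim
    filter_upwards [hlim.eventually_lt_const hF] with m hm
    refine lt_of_le_of_lt ?_ hm
    rw [div_le_iff₀ (hpos m)]
    have h := hbound (hA.finite m).toFinset
    rw [Set.Finite.coe_toFinset, hcard] at h
    refine h.trans_eq ?_
    have := (hpos m).ne'
    field_simp

lemma colouredPatternEntropy_kFree {k n : ℕ} (hnk : 1 < n * k)
    {A : ℕ → Set (Fin n → ℤ)} (hA : IsVanHove Measure.count A) :
    colouredPatternEntropy Measure.count A (kFree k n) Set.univ =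
      (((internalHaar k n).real (kFreeWindow k n) * Real.log 2 : ℝ) : EReal) :=
  ((continuous_coe_real_ereal.tendsto _).comp
    (tendsto_log_colouredComplexity_kFree hnk hA)).limsup_eq

lemma entropyBound_kFreeWindow (k n : ℕ) :
    entropyBound (diagonalLattice k n) Measure.count (internalHaar k n) (kFreeWindow k n) =
      (internalHaar k n).real (kFreeWindow k n) * Real.log 2 := by
  rw [entropyBound, latticeDensity_diagonalLattice, frontier_kFreeWindow, one_mul]

lemma entropyBound_compl_kFreeWindow (k n : ℕ) :
    entropyBound (diagonalLattice k n) Measure.count (internalHaar k n) (kFreeWindow k n)ᶜ =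
      (internalHaar k n).real (kFreeWindow k n) * Real.log 2 := by
  rw [← entropyBound_kFreeWindow, entropyBound, entropyBound, frontier_compl]

end WeakModelSet

open WeakModelSet in
theorem mainTheorem5 (k n : ℕ) (hnk : 1 < n * k) :
    -- the cut-and-project scheme `(ℤⁿ, H, L)` with its measures
    IsCutAndProjectScheme (Fin n → ℤ) (Internal k n) (diagonalLattice k n) ∧
    (internalHaar k n).IsAddHaarMeasure ∧
    latticeDensity (diagonalLattice k n) Measure.count (internalHaar k n) = 1 ∧
    -- `ℤⁿ = Λ(H)` is a regular model set
    IsRegularWindow (internalHaar k n) (Set.univ : Set (Internal k n)) ∧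
    projectionSet (diagonalLattice k n) Set.univ = Set.univ ∧
    -- the `k`-free lattice points and their window
    projectionSet (diagonalLattice k n) (kFreeWindow k n) = kFree k n ∧
    IsCompact (closure (kFreeWindow k n)) ∧
    frontier (kFreeWindow k n) = kFreeWindow k n ∧
    ((internalHaar k n).real (kFreeWindow k n) : ℂ) = 1 / riemannZeta ((n * k : ℕ) : ℂ) ∧
    0 < (internalHaar k n).real (kFreeWindow k n) ∧
    -- the complementary set and its window
    projectionSet (diagonalLattice k n) (kFreeWindow k n)ᶜ = (kFree k n)ᶜ ∧
    IsCompact (closure (kFreeWindow k n)ᶜ) ∧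
    (interior (kFreeWindow k n)ᶜ).Nonempty ∧
    -- the entropies along centred van Hove sequences of cubes
    ∀ A : ℕ → Set (Fin n → ℤ), IsVanHove Measure.count A →
      (∀ m, IsCube (A m) ∧ 0 ∈ A m) →
      colouredPatternEntropy Measure.count A (kFree k n) Set.univ =
        (((internalHaar k n).real (kFreeWindow k n) * Real.log 2 : ℝ) : EReal) ∧
      colouredPatternEntropy Measure.count A (kFree k n) Set.univ =
        (entropyBound (diagonalLattice k n) Measure.count (internalHaar k n)
          (kFreeWindow k n) : EReal) ∧
      colouredPatternEntropy Measure.count A (kFree k n)ᶜ Set.univ =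
        colouredPatternEntropy Measure.count A (kFree k n) Set.univ ∧
      colouredPatternEntropy Measure.count A (kFree k n)ᶜ Set.univ =
        (entropyBound (diagonalLattice k n) Measure.count (internalHaar k n)
          (kFreeWindow k n)ᶜ : EReal) := by

  refine ⟨isCutAndProjectScheme_diagonalLattice k n, inferInstance,
    latticeDensity_diagonalLattice k n, ⟨isClosed_closure.isCompact, ?_, by simp⟩, ?_, ?_,
    isClosed_closure.isCompact, frontier_kFreeWindow k n, internalHaar_real_kFreeWindow k n hnk,
    internalHaar_real_kFreeWindow_pos k n hnk, ?_, isClosed_closure.isCompact,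
    interior_compl_kFreeWindow_nonempty k n, fun A hA _ => ?_⟩
  · rw [interior_univ]
    exact Set.univ_nonempty
  · ext x
    simp [mem_projectionSet_diagonalLattice]
  · ext x
    rw [mem_projectionSet_diagonalLattice, starMap_mem_kFreeWindow]
  · ext x
    rw [mem_projectionSet_diagonalLattice, Set.mem_compl_iff, starMap_mem_kFreeWindow,
      Set.mem_compl_iff]
  · rw [colouredPatternEntropy_compl_univ, colouredPatternEntropy_kFree hnk hA,
      entropyBound_kFreeWindow, entropyBound_compl_kFreeWindow]
    exact ⟨rfl, rfl, rfl, rfl⟩
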